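/- Let $\mathbb{M}_n$ be the algebra of complex $n\times n$ matrices, and for an interval $\Omega\subset[0,\infty)$ let $\mathbb{M}_n\{\Omega\}$ be the set of Hermitian matrices in $\mathbb{M}_n$ with spectrum in $\Omega$. A function $f$ is called doubly concave on $\Omega$ if it is non-negative, continuous and concave on $\Omega$ and satisfies $f(\sqrt{xy})\ge\sqrt{f(x)f(y)}$ for all $x,y\in\Omega$. For positive semidefinite $A,B\in\mathbb{M}_m$, with $\lambda_1(\cdot)\ge\dots\ge\lambda_m(\cdot)$ denoting the eigenvalues in decreasing order with multiplicities, write $A\prec^{w(\log)}B$ if $\prod_{j=1}^k\lambda_{m+1-j}(A)\ge\prod_{j=1}^k\lambda_{m+1-j}(B)$ for $k=1,\dots,m$. The order $\ge$ between Hermitian matrices is the Loewner order. Theorem. Let $\mathbb{E}:\mathbb{M}_n\to\mathbb{M}_m$ be a positive linear map that is sub-unital, i.e. $\mathbb{E}(I)\le I$. Let $f$ be doubly concave on $\Omega$, $Z\in\mathbb{M}_n\{\Omega\}$ and $p\in(0,1]$, and put $\mathbb{E}_p(X)=\mathbb{E}(X^p)^{1/p}$ for positive semidefinite $X\in\mathbb{M}_n$.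 Assume that $\mathbb{E}$ is unital ($\mathbb{E}(I)=I$) or that $0\in\Omega$. Then $\mathbb{E}_p(Z)\in\mathbb{M}_m\{\Omega\}$ (so that $f(\mathbb{E}_p(Z))$ is defined) and $$f(\mathbb{E}_p(Z))\prec^{w(\log)}\mathbb{E}_p(f(Z)).$$ If furthermore $f$ is monotone (non-decreasing or non-increasing) on $\Omega$, then there is a unitary $V\in\mathbb{M}_m$ such that $$f(\mathbb{E}_p(Z))\ge V\,\mathbb{E}_p(f(Z))\,V^*.$$ Moreover, these assertions also hold for $p=0$, where $\mathbb{E}_0(X)=\exp\mathbb{E}(\log X)$ for positive definite $X$, when $\mathbb{E}$ is unital and both $Z$ and $f(Z)$ are invertible. -/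

import Mathlib

open scoped ComplexOrder MatrixOrder

/-- `f` is doubly concave on the interval `Ω ⊆ [0, ∞)`: it is non-negative, continuous, concave and
geometrically concave on `Ω`. Values of `f` outside `Ω` play no role. -/
structure DoublyConcaveOn (Ω : Set ℝ) (f : ℝ → ℝ) : Prop where
  ordConnected : Ω.OrdConnected
  subset_nonneg : Ω ⊆ Set.Ici 0
  nonneg : ∀ x ∈ Ω, 0 ≤ f x
  continuousOn : ContinuousOn f Ω
  concaveOn : ConcaveOn ℝ Ω f
  geomConcave : ∀ x ∈ Ω, ∀ y ∈ Ω, √(f x * f y) ≤ f √(x * y)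

/-- The `i`-th eigenvalue of a Hermitian matrix, in decreasing order with multiplicities,
`i = 0, …, m - 1`. -/
noncomputable def decEigenvalue {m : ℕ} {A : Matrix (Fin m) (Fin m) ℂ} (hA : A.IsHermitian)
    (i : Fin m) : ℝ :=
  hA.eigenvalues₀ (Fin.cast (Fintype.card_fin m).symm i)

/-- The log-supermajorization `A ≺^{w(log)} B` of positive semidefinite matrices: for `k = 1, …, m`,
the product of the `k` smallest eigenvalues of `A` is at least that of `B`. The `j`-th factor,
`j = 0, …, k - 1`, is the eigenvalue number `m - 1 - j` (from `0`) in decreasing order. -/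
def LogSupermajorized {m : ℕ} (A B : Matrix (Fin m) (Fin m) ℂ) : Prop :=
  ∃ (hA : A.PosSemidef) (hB : B.PosSemidef), ∀ k : ℕ, 1 ≤ k → k ≤ m →
    ∏ j : Fin m with j.val < k, decEigenvalue hB.isHermitian j.rev ≤
      ∏ j : Fin m with j.val < k, decEigenvalue hA.isHermitian j.rev

/-- `E_p(Z) = E(Z ^ p) ^ (1 / p)` for `p ≠ 0`, and `E_0(Z) = exp (E (log Z))`. Functions of
matrices are taken in the functional calculus of Hermitian matrices. -/
noncomputable def powerMap {n m : ℕ}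
    (E : Matrix (Fin n) (Fin n) ℂ →ₚ[ℂ] Matrix (Fin m) (Fin m) ℂ) (p : ℝ)
    (Z : Matrix (Fin n) (Fin n) ℂ) : Matrix (Fin m) (Fin m) ℂ :=
  if p = 0 then cfc Real.exp (E (cfc Real.log Z))
  else cfc (fun t : ℝ => t ^ (1 / p)) (E (cfc (fun t : ℝ => t ^ p) Z))

/-! In the coordinate `φ(t) = t ^ p` (or `log t`, for `p = 0`), with inverse `h`, the map `E_p`
becomes `E` and `f` becomes `G = φ ∘ f ∘ h`. The crux is that double concavity makes `G` concave
(`DoublyConcaveOn.concaveOn_rpow`, `DoublyConcaveOn.concaveOn_log_comp_exp`).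

For a unit vector `e`, the functional `X ↦ ⟨e, E(X) e⟩` is a sub-probability measure on the
eigenvalues of `Z`. Jensen then gives `⟨e, B e⟩ ≤ G(⟨e, S e⟩)` with `S = E(φ(Z))` and `B =
E(φ(f(Z)))`. Mass missing when `E` is only sub-unital is placed at `0`.

Both conclusions follow from this scalar inequality (`comparison_of_concaveOn`). On eigenvectors of
`S`, the weights against an eigenbasis of `B` are doubly stochastic, and the arithmetic–geometric
mean inequality passes to products. If `f` is monotone, a dimension count compares the sorted
eigenvalues one by one, which gives the unitary. -/

/-! ### Concavity in logarithmic coordinates. -/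

/-- A continuous midpoint-concave function on `[0, 1]` that is non-negative at the endpoints is
non-negative. -/
lemma nonneg_of_midpoint_concave {φ : ℝ → ℝ} (hc : ContinuousOn φ (Set.Icc 0 1))
    (hm : ∀ s ∈ Set.Icc (0 : ℝ) 1, ∀ t ∈ Set.Icc (0 : ℝ) 1, (φ s + φ t) / 2 ≤ φ ((s + t) / 2))
    (h0 : 0 ≤ φ 0) (h1 : 0 ≤ φ 1) {t : ℝ} (ht : t ∈ Set.Icc (0 : ℝ) 1) : 0 ≤ φ t := by
  obtain ⟨t₀, ht₀, hmin⟩ := isCompact_Icc.exists_isMinOn ⟨t, ht⟩ hc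
  refine le_trans ?_ (hmin ht)
  by_contra! hneg
  -- At the leftmost minimizer `w`, the points `w ± d` violate midpoint concavity: the left value is
  -- strictly larger than the minimum.
  have hK : IsCompact (Set.Icc (0 : ℝ) 1 ∩ φ ⁻¹' {φ t₀}) :=
    isCompact_Icc.of_isClosed_subset
      (hc.preimage_isClosed_of_isClosed isClosed_Icc isClosed_singleton) Set.inter_subset_left
  obtain ⟨w, ⟨⟨hw0, hw1⟩, hw⟩, hleast⟩ := hK.exists_isLeast ⟨t₀, ht₀, rfl⟩
  simp only [Set.mem_preimage, Set.mem_singleton_iff] at hw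
  have hw0' : 0 < w := lt_of_le_of_ne hw0 (by rintro rfl; linarith)
  have hw1' : w < 1 := lt_of_le_of_ne hw1 (by rintro rfl; linarith)
  set d := min w (1 - w) with hd
  have hd0 : 0 < d := lt_min hw0' (by linarith)
  have hdw : d ≤ w := min_le_left _ _
  have hdw' : d ≤ 1 - w := min_le_right _ _
  have hl : w - d ∈ Set.Icc (0 : ℝ) 1 := ⟨by linarith, by linarith⟩
  have hr : w + d ∈ Set.Icc (0 : ℝ) 1 := ⟨by linarith, by linarith⟩
  have hlt : φ t₀ < φ (w - d) := by
    refine lt_of_le_of_ne (hmin hl) fun h => ?_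
    have := hleast ⟨hl, h.symm⟩
    linarith
  have hge : φ t₀ ≤ φ (w + d) := hmin hr
  have := hm _ hl _ hr
  rw [show (w - d + (w + d)) / 2 = w by ring, hw] at this
  linarith

lemma DoublyConcaveOn.pos_of_mem_uIcc {Ω : Set ℝ} {f : ℝ → ℝ} (hf : DoublyConcaveOn Ω f)
    {x y z : ℝ} (hx : x ∈ Ω) (hy : y ∈ Ω) (hfx : 0 < f x) (hfy : 0 < f y)
    (hz : z ∈ Set.uIcc x y) : 0 < f z := by
  rw [← segment_eq_uIcc] at hz
  exact (lt_min hfx hfy).trans_le (hf.concaveOn.ge_on_segment hx hy hz)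

lemma Real.exp_add_mem_uIcc {x y a b : ℝ} (ha : 0 ≤ a) (hb : 0 ≤ b) (hab : a + b = 1) :
    Real.exp (a * x + b * y) ∈ Set.uIcc (Real.exp x) (Real.exp y) := by
  have h : a * x + b * y ∈ Set.uIcc x y := by
    rw [← segment_eq_uIcc]
    exact ⟨a, b, ha, hb, hab, rfl⟩
  rcases le_total x y with hxy | hxy
  · rw [Set.uIcc_of_le hxy] at h
    rw [Set.uIcc_of_le (Real.exp_le_exp.2 hxy)]
    exact ⟨Real.exp_le_exp.2 h.1, Real.exp_le_exp.2 h.2⟩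
  · rw [Set.uIcc_of_ge hxy] at h
    rw [Set.uIcc_of_ge (Real.exp_le_exp.2 hxy)]
    exact ⟨Real.exp_le_exp.2 h.1, Real.exp_le_exp.2 h.2⟩

/-- A doubly concave function is concave in logarithmic coordinates, where it is positive. -/
lemma DoublyConcaveOn.concaveOn_log_comp_exp {Ω : Set ℝ} {f : ℝ → ℝ} (hf : DoublyConcaveOn Ω f) :
    ConcaveOn ℝ {s | Real.exp s ∈ Ω ∧ 0 < f (Real.exp s)} (fun s => Real.log (f (Real.exp s))) := by
  have key : ∀ x y a b : ℝ, Real.exp x ∈ Ω → Real.exp y ∈ Ω → 0 < f (Real.exp x) →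
      0 < f (Real.exp y) → 0 ≤ a → 0 ≤ b → a + b = 1 →
      Real.exp (a * x + b * y) ∈ Ω ∧ 0 < f (Real.exp (a * x + b * y)) := by
    intro x y a b hx hy hfx hfy ha hb hab
    have h := Real.exp_add_mem_uIcc (x := x) (y := y) ha hb hab
    exact ⟨hf.ordConnected.uIcc_subset hx hy h, hf.pos_of_mem_uIcc hx hy hfx hfy h⟩
  refine ⟨fun x hx y hy a b ha hb hab => key x y a b hx.1 hy.1 hx.2 hy.2 ha hb hab, ?_⟩
  rintro x ⟨hx, hfx⟩ y ⟨hy, hfy⟩ a b ha hb hab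
  obtain rfl : a = 1 - b := by linarith
  have hmem : ∀ t ∈ Set.Icc (0 : ℝ) 1, Real.exp ((1 - t) * x + t * y) ∈ Ω ∧
      0 < f (Real.exp ((1 - t) * x + t * y)) := fun t ht =>
    key x y _ _ hx hy hfx hfy (by linarith [ht.2]) ht.1 (by ring)
  -- The function minus its chord vanishes at both endpoints, and geometric concavity of `f` is
  -- exactly its midpoint concavity.
  have := nonneg_of_midpoint_concave
    (φ := fun t => Real.log (f (Real.exp ((1 - t) * x + t * y))) -
      ((1 - t) * Real.log (f (Real.exp x)) + t * Real.log (f (Real.exp y)))) ?_ ?_ ?_ ?_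
      (t := b) ⟨hb, by linarith⟩
  · simpa using this
  · refine ContinuousOn.sub (ContinuousOn.log (hf.continuousOn.comp (by fun_prop)
      fun t ht => (hmem t ht).1) fun t ht => (hmem t ht).2.ne') (by fun_prop)
  · intro s hs t ht
    obtain ⟨hs1, hs2⟩ := hmem s hs
    obtain ⟨ht1, ht2⟩ := hmem t ht
    have h := hf.geomConcave _ hs1 _ ht1
    rw [← Real.exp_add, Real.sqrt_eq_rpow (Real.exp _), ← Real.exp_mul,
      show ((1 - s) * x + s * y + ((1 - t) * x + t * y)) * (1 / 2) =
        (1 - (s + t) / 2) * x + (s + t) / 2 * y by ring] at h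
    have h' := Real.log_le_log (Real.sqrt_pos.2 (mul_pos hs2 ht2)) h
    rw [Real.log_sqrt (mul_pos hs2 ht2).le, Real.log_mul hs2.ne' ht2.ne'] at h'
    linarith
  · simp
  · simp

/-! ### Concavity in power coordinates. -/

/-- Reverse Minkowski inequality for weighted power means of two numbers, with `0 < p ≤ 1`. -/
lemma Real.add_rpow_le_of_rpow_eq {p l₁ l₂ u₁ u₂ v₁ v₂ U V : ℝ} (hp : 0 < p) (hp1 : p ≤ 1)
    (hl₁ : 0 ≤ l₁) (hl₂ : 0 ≤ l₂) (hu₁ : 0 ≤ u₁) (hu₂ : 0 ≤ u₂) (hv₁ : 0 ≤ v₁) (hv₂ : 0 ≤ v₂)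
    (hU : 0 ≤ U) (hV : 0 ≤ V) (hUp : l₁ * u₁ ^ p + l₂ * u₂ ^ p = U ^ p)
    (hVp : l₁ * v₁ ^ p + l₂ * v₂ ^ p = V ^ p) :
    (U + V) ^ p ≤ l₁ * (u₁ + v₁) ^ p + l₂ * (u₂ + v₂) ^ p := by
  rcases hU.eq_or_lt with rfl | hU
  · rw [zero_add, ← hVp]
    gcongr <;> linarith
  rcases hV.eq_or_lt with rfl | hV
  · rw [add_zero, ← hUp]
    gcongr <;> linarith
  have hS : 0 < U + V := by linarith
  -- Concavity of `t ^ p` at `u / U` and `v / V`, with weights chosen so that the mean is `(u + v) /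
  -- (U + V)`.
  have key : ∀ u v : ℝ, 0 ≤ u → 0 ≤ v →
      (U / (U + V) * (u ^ p / U ^ p) + V / (U + V) * (v ^ p / V ^ p)) * (U + V) ^ p ≤
        (u + v) ^ p := by
    intro u v hu hv
    have h := (Real.concaveOn_rpow hp.le hp1).2
      (Set.mem_Ici.2 (show 0 ≤ u / U by positivity)) (Set.mem_Ici.2 (show 0 ≤ v / V by positivity))
      (show 0 ≤ U / (U + V) by positivity) (show 0 ≤ V / (U + V) by positivity) (by field_simp)
    simp only [smul_eq_mul] at h
    rw [show U / (U + V) * (u / U) + V / (U + V) * (v / V) = (u + v) / (U + V) by field_simp,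
      Real.div_rpow hu hU.le, Real.div_rpow hv hV.le, Real.div_rpow (by linarith) hS.le,
      le_div_iff₀ (by positivity)] at h
    exact h
  have h₁ := mul_le_mul_of_nonneg_left (key u₁ v₁ hu₁ hv₁) hl₁
  have h₂ := mul_le_mul_of_nonneg_left (key u₂ v₂ hu₂ hv₂) hl₂
  have hUp' : 0 < U ^ p := by positivity
  have hVp' : 0 < V ^ p := by positivity
  refine le_trans (le_of_eq ?_) (add_le_add h₁ h₂)
  calc (U + V) ^ p
      = (U / (U + V) + V / (U + V)) * (U + V) ^ p := by
        rw [← add_div, div_self hS.ne', one_mul]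
    _ = (U / (U + V) * ((l₁ * u₁ ^ p + l₂ * u₂ ^ p) / U ^ p) +
          V / (U + V) * ((l₁ * v₁ ^ p + l₂ * v₂ ^ p) / V ^ p)) * (U + V) ^ p := by
        rw [hUp, hVp, div_self hUp'.ne', div_self hVp'.ne', mul_one, mul_one]
    _ = _ := by ring

/-- A doubly concave function dominates power means: the two-point inequality. -/
lemma DoublyConcaveOn.rpow_add_le {Ω : Set ℝ} {f : ℝ → ℝ} (hf : DoublyConcaveOn Ω f)
    {p l₁ l₂ x y z : ℝ} (hp : 0 < p) (hp1 : p ≤ 1) (hl₁ : 0 < l₁) (hl₂ : 0 < l₂)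
    (hl : l₁ + l₂ = 1) (hx : x ∈ Ω) (hy : y ∈ Ω) (hxy : x < y) (hz : 0 ≤ z)
    (hzp : l₁ * x ^ p + l₂ * y ^ p = z ^ p) :
    l₁ * f x ^ p + l₂ * f y ^ p ≤ f z ^ p := by
  have hx0 : 0 ≤ x := hf.subset_nonneg hx
  have hy0 : 0 < y := hx0.trans_lt hxy
  have hfx := hf.nonneg x hx
  have hfy := hf.nonneg y hy
  have hxyp : x ^ p ≤ y ^ p := by gcongr
  have hl₁' : l₁ = 1 - l₂ := by linarith
  have hxz : x ≤ z := (Real.rpow_le_rpow_iff hx0 hz hp).1 (by rw [← hzp, hl₁']; nlinarith)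
  have hzy : z ≤ y := (Real.rpow_le_rpow_iff hz hy0.le hp).1 (by
    rw [← hzp, hl₁']
    have : l₂ ≤ 1 := by linarith
    nlinarith)
  have hzΩ : z ∈ Ω := hf.ordConnected.out hx hy ⟨hxz, hzy⟩
  have hd : 0 < y - x := by linarith
  -- the chord of `f` over `[x, y]`
  have hchord : (y - z) / (y - x) * f x + (z - x) / (y - x) * f y ≤ f z := by
    have h := hf.concaveOn.2 hx hy
      (show 0 ≤ (y - z) / (y - x) from div_nonneg (by linarith) hd.le)
      (show 0 ≤ (z - x) / (y - x) from div_nonneg (by linarith) hd.le)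
      (by rw [← add_div, div_eq_one_iff_eq hd.ne']; ring)
    simp only [smul_eq_mul] at h
    rwa [show (y - z) / (y - x) * x + (z - x) / (y - x) * y = z by field_simp; ring] at h
  set M := l₁ * f x ^ p + l₂ * f y ^ p with hM
  have hM0 : 0 ≤ M := by positivity
  set U := M ^ p⁻¹ with hU
  have hU0 : 0 ≤ U := by positivity
  have hUp : M = U ^ p := by rw [hU, Real.rpow_inv_rpow hM0 hp.ne']
  suffices h : U ≤ f z by
    rw [hUp]
    gcongr
  -- Three cases for the chord of `f`. If it does not increase, adding `β * t` makes it constant; if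
  -- it increases with intercept at most `0`, adding a constant makes it `β * t`. Reverse Minkowski
  -- then bounds the `p`-mean `U` by the chord at `z`. If it increases with positive intercept, a
  -- power `c * t ^ k` with `0 ≤ k ≤ 1` replaces the chord.
  rcases le_or_gt (f y) (f x) with hab | hab
  · have hβ : 0 ≤ (f x - f y) / (y - x) := div_nonneg (by linarith) hd.le
    set β := (f x - f y) / (y - x) with hβd
    have hβ' : β * (y - x) = f x - f y := by rw [hβd]; field_simp
    have h := Real.add_rpow_le_of_rpow_eq (V := β * z) hp hp1 hl₁.le hl₂.le hfx hfy
      (mul_nonneg hβ hx0) (mul_nonneg hβ hy0.le) hU0 (mul_nonneg hβ hz) hUp (by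
        rw [Real.mul_rpow hβ hx0, Real.mul_rpow hβ hy0.le, Real.mul_rpow hβ hz, ← hzp]; ring)
    rw [show f y + β * y = f x + β * x by linarith, ← add_mul, hl, one_mul,
      Real.rpow_le_rpow_iff (by positivity) (by positivity) hp] at h
    refine le_trans ?_ hchord
    have : (y - z) / (y - x) * f x + (z - x) / (y - x) * f y = f x + β * x - β * z := by
      rw [hβd]; field_simp; ring
    linarith
  rcases le_or_gt (f x * y) (f y * x) with hba | hba
  · have hβ : 0 ≤ (f y - f x) / (y - x) := div_nonneg (by linarith) hd.le
    set β := (f y - f x) / (y - x) with hβd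
    have hβ' : β * (y - x) = f y - f x := by rw [hβd]; field_simp
    have hα : 0 ≤ β * x - f x := by
      have : β * x - f x = (f y * x - f x * y) / (y - x) := by rw [hβd]; field_simp; ring
      rw [this]
      exact div_nonneg (by linarith) hd.le
    have h := Real.add_rpow_le_of_rpow_eq (V := β * x - f x) hp hp1 hl₁.le hl₂.le hfx hfy
      hα hα hU0 hα hUp (by rw [← add_mul, hl, one_mul])
    rw [show f x + (β * x - f x) = β * x by ring, show f y + (β * x - f x) = β * y by linarith,
      Real.mul_rpow hβ hx0, Real.mul_rpow hβ hy0.le,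
      show l₁ * (β ^ p * x ^ p) + l₂ * (β ^ p * y ^ p) = β ^ p * (l₁ * x ^ p + l₂ * y ^ p) by ring,
      hzp, ← Real.mul_rpow hβ hz,
      Real.rpow_le_rpow_iff (by positivity) (by positivity) hp] at h
    refine le_trans ?_ hchord
    have : (y - z) / (y - x) * f x + (z - x) / (y - x) * f y = f x - β * x + β * z := by
      rw [hβd]; field_simp; ring
    linarith
  have hfx0 : 0 < f x := by
    refine hfx.lt_of_ne fun h => ?_
    rw [← h, zero_mul] at hba
    exact hba.not_ge (by positivity)
  have hx0' : 0 < x := by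
    refine hx0.lt_of_ne fun h => ?_
    subst h
    -- Geometric concavity at `0` and `y` would force `f y ≤ f 0`.
    have h' := hf.geomConcave 0 hx y hy
    rw [zero_mul, Real.sqrt_zero, Real.sqrt_le_left hfx0.le] at h'
    nlinarith
  have hfy0 : 0 < f y := hfx0.trans hab
  have hz0 : 0 < z := hx0'.trans_le hxz
  have hD : 0 < Real.log y - Real.log x := sub_pos.2 (Real.log_lt_log hx0' hxy)
  set k := (Real.log (f y) - Real.log (f x)) / (Real.log y - Real.log x) with hk
  have hkD : k * (Real.log y - Real.log x) = Real.log (f y) - Real.log (f x) := by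
    rw [hk]; field_simp
  have hk0 : 0 ≤ k := div_nonneg (sub_nonneg.2 (Real.log_le_log hfx0 hab.le)) hD.le
  have hk1 : k ≤ 1 := by
    rw [hk, div_le_one hD]
    have h := Real.log_le_log (by positivity) hba.le
    rw [Real.log_mul hfy0.ne' hx0'.ne', Real.log_mul hfx0.ne' hy0.ne'] at h
    linarith
  have hfyk : f y = f x * (y / x) ^ k := by
    refine Real.log_injOn_pos hfy0 (Set.mem_Ioi.2 (by positivity)) ?_
    rw [Real.log_mul hfx0.ne' (by positivity), Real.log_rpow (by positivity),
      Real.log_div hy0.ne' hx0'.ne', hkD]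
    ring
  have hfzk : f x * (z / x) ^ k ≤ f z := by
    have hfz0 : 0 < f z := hf.pos_of_mem_uIcc hx hy hfx0 hfy0
      (by rw [Set.uIcc_of_le hxy.le]; exact ⟨hxz, hzy⟩)
    rw [← Real.log_le_log_iff (by positivity) hfz0, Real.log_mul hfx0.ne' (by positivity),
      Real.log_rpow (by positivity), Real.log_div hz0.ne' hx0'.ne']
    have hlxz := Real.log_le_log hx0' hxz
    have hlzy := Real.log_le_log hz0 hzy
    set t := (Real.log z - Real.log x) / (Real.log y - Real.log x) with ht
    have htD : t * (Real.log y - Real.log x) = Real.log z - Real.log x := by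
      rw [ht]; field_simp
    have h := hf.concaveOn_log_comp_exp.2 (x := Real.log x) (y := Real.log y)
      (by simp [Real.exp_log hx0', hx, hfx0]) (by simp [Real.exp_log hy0, hy, hfy0])
      (show 0 ≤ 1 - t by
        rw [sub_nonneg, ht, div_le_one hD]; linarith)
      (show 0 ≤ t from div_nonneg (by linarith) hD.le) (by ring)
    simp only [smul_eq_mul] at h
    rw [show (1 - t) * Real.log x + t * Real.log y = Real.log z by linarith, Real.exp_log hx0',
      Real.exp_log hy0, Real.exp_log hz0] at h
    refine le_trans (le_of_eq ?_) h
    rw [← htD]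
    linear_combination t * hkD
  refine le_trans ?_ hfzk
  have hcomm : ∀ w : ℝ, 0 ≤ w → (w ^ k) ^ p = (w ^ p) ^ k := fun w hw => by
    rw [← Real.rpow_mul hw, ← Real.rpow_mul hw, mul_comm]
  -- Dividing by `f x ^ p` leaves concavity of `t ^ k` at `1` and `(y / x) ^ p`, whose weighted mean
  -- is `(z / x) ^ p`.
  rw [← Real.rpow_le_rpow_iff hU0 (by positivity) hp, ← hUp, hM, hfyk,
    Real.mul_rpow hfx (by positivity), Real.mul_rpow hfx (by positivity), hcomm _ (by positivity),
    hcomm _ (by positivity), Real.div_rpow hz hx0, ← hzp, add_div,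
    mul_div_assoc, mul_div_assoc, div_self (by positivity), ← Real.div_rpow hy0.le hx0]
  have h := (Real.concaveOn_rpow hk0 hk1).2 (Set.mem_Ici.2 zero_le_one)
    (Set.mem_Ici.2 (show 0 ≤ (y / x) ^ p by positivity)) hl₁.le hl₂.le hl
  simp only [smul_eq_mul, Real.one_rpow] at h
  have := mul_le_mul_of_nonneg_left h (show 0 ≤ f x ^ p by positivity)
  linarith

/-- The `p`-th power transform of a doubly concave function is concave. -/
lemma DoublyConcaveOn.concaveOn_rpow {Ω : Set ℝ} {f : ℝ → ℝ} (hf : DoublyConcaveOn Ω f) {p : ℝ}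
    (hp : 0 < p) (hp1 : p ≤ 1) :
    ConcaveOn ℝ {s | 0 ≤ s ∧ s ^ (1 / p) ∈ Ω} (fun s => f (s ^ (1 / p)) ^ p) := by
  have hinv : ∀ s : ℝ, 0 ≤ s → (s ^ (1 / p)) ^ p = s := fun s hs => by
    rw [one_div, Real.rpow_inv_rpow hs hp.ne']
  refine LinearOrder.concaveOn_of_lt ?_ ?_
  · refine Set.OrdConnected.convex ⟨fun s hs t ht u hu => ?_⟩
    have hu0 : 0 ≤ u := hs.1.trans hu.1
    have hp' : 0 ≤ 1 / p := by positivity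
    exact ⟨hu0, hf.ordConnected.out hs.2 ht.2
      ⟨Real.rpow_le_rpow hs.1 hu.1 hp', Real.rpow_le_rpow hu0 hu.2 hp'⟩⟩
  · rintro s ⟨hs, hsΩ⟩ t ⟨ht, htΩ⟩ hst a b ha hb hab
    simp only [smul_eq_mul]
    have hc : 0 ≤ a * s + b * t := by positivity
    refine hf.rpow_add_le hp hp1 ha hb hab hsΩ htΩ
      (Real.rpow_lt_rpow hs hst (by positivity)) (by positivity) ?_
    rw [hinv _ hs, hinv _ ht, hinv _ hc]

/-! ### Matching two lists of the same values. -/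

/-- Fibres over each value have equal cardinality, so bijections of fibres glue. -/
lemma exists_equiv_of_map_univ_eq {ι κ γ : Type*} [Fintype ι] [Fintype κ]
    {f : ι → γ} {g : κ → γ}
    (h : Multiset.map f Finset.univ.val = Multiset.map g Finset.univ.val) :
    ∃ σ : ι ≃ κ, ∀ i, g (σ i) = f i := by
  classical
  have hcard : ∀ c, Fintype.card {i // f i = c} = Fintype.card {j // g j = c} := by
    intro c
    have hc := congrArg (Multiset.count c) h
    rw [Multiset.count_map, Multiset.count_map] at hc
    rw [Fintype.card_subtype, Fintype.card_subtype]
    simpa [Finset.card_def, eq_comm] using hc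
  exact ⟨Equiv.ofFiberEquiv fun c => Fintype.equivOfCardEq (hcard c),
    fun i => Equiv.ofFiberEquiv_map _ i⟩

/-! ### Quadratic forms of diagonalized matrices. -/

namespace Matrix

variable {ι : Type*} [Fintype ι]

/-- The real part of the quadratic form of a matrix. -/
noncomputable def reForm (M : Matrix ι ι ℂ) (e : ι → ℂ) : ℝ := (star e ⬝ᵥ M *ᵥ e).re

lemma reForm_sub (M N : Matrix ι ι ℂ) (e : ι → ℂ) :
    reForm (M - N) e = reForm M e - reForm N e := by
  simp [reForm, sub_mulVec, dotProduct_sub]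

lemma reForm_add (M N : Matrix ι ι ℂ) (e : ι → ℂ) :
    reForm (M + N) e = reForm M e + reForm N e := by
  simp [reForm, add_mulVec, dotProduct_add]

lemma reForm_smul (c : ℝ) (M : Matrix ι ι ℂ) (e : ι → ℂ) :
    reForm ((c : ℂ) • M) e = c * reForm M e := by
  simp [reForm, smul_mulVec]

lemma reForm_nonneg {M : Matrix ι ι ℂ} (hM : 0 ≤ M) (e : ι → ℂ) : 0 ≤ reForm M e :=
  (Complex.le_def.1 ((nonneg_iff_posSemidef.1 hM).dotProduct_mulVec_nonneg e)).1

lemma reForm_mono {M N : Matrix ι ι ℂ} (h : M ≤ N) (e : ι → ℂ) : reForm M e ≤ reForm N e := by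
  rw [← sub_nonneg, ← reForm_sub]
  exact reForm_nonneg (sub_nonneg.2 h) e

variable [DecidableEq ι]

/-- The matrix `U * diag d * U⋆` with real diagonal `d`. -/
noncomputable def conjDiag (U : Matrix ι ι ℂ) (d : ι → ℝ) : Matrix ι ι ℂ :=
  U * diagonal (fun i => (d i : ℂ)) * star U

lemma conjDiag_add (U : Matrix ι ι ℂ) (d d' : ι → ℝ) :
    conjDiag U (d + d') = conjDiag U d + conjDiag U d' := by
  simp only [conjDiag, Pi.add_apply, Complex.ofReal_add, ← diagonal_add, mul_add, add_mul]

lemma conjDiag_smul (U : Matrix ι ι ℂ) (c : ℝ) (d : ι → ℝ) :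
    conjDiag U (c • d) = (c : ℂ) • conjDiag U d := by
  have : diagonal (fun i => (((c • d) i : ℝ) : ℂ)) = (c : ℂ) • diagonal (fun i => (d i : ℂ)) := by
    rw [← diagonal_smul]
    congr 1
    ext i
    simp
  rw [conjDiag, this, Matrix.mul_smul, Matrix.smul_mul, conjDiag]

lemma conjDiag_sub (U : Matrix ι ι ℂ) (d d' : ι → ℝ) :
    conjDiag U (d - d') = conjDiag U d - conjDiag U d' := by
  rw [eq_sub_iff_add_eq, ← conjDiag_add, sub_add_cancel]

lemma conjDiag_one {U : Matrix ι ι ℂ} (hU : U ∈ unitaryGroup ι ℂ) :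
    conjDiag U 1 = 1 := by
  simp [conjDiag, mem_unitaryGroup_iff.1 hU]

lemma conjDiag_posSemidef (U : Matrix ι ι ℂ) {d : ι → ℝ} (hd : 0 ≤ d) :
    (conjDiag U d).PosSemidef :=
  (PosSemidef.diagonal (d := fun i => (d i : ℂ))
    (fun i => Complex.zero_le_real.2 (hd i))).mul_mul_conjTranspose_same U

lemma conjDiag_mono (U : Matrix ι ι ℂ) {d d' : ι → ℝ} (h : d ≤ d') :
    conjDiag U d ≤ conjDiag U d' := by
  rw [le_iff, ← conjDiag_sub]
  exact conjDiag_posSemidef U (sub_nonneg.2 h)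

lemma IsHermitian.exists_conjDiag {A : Matrix ι ι ℂ} (hA : A.IsHermitian) :
    ∃ U ∈ unitaryGroup ι ℂ, ∃ d : ι → ℝ, spectrum ℝ A = Set.range d ∧ A = conjDiag U d ∧
      ∀ φ : ℝ → ℝ, cfc φ A = conjDiag U (φ ∘ d) :=
  ⟨hA.eigenvectorUnitary, hA.eigenvectorUnitary.2, hA.eigenvalues,
    hA.spectrum_real_eq_range_eigenvalues, hA.spectral_theorem, fun φ => hA.cfc_eq φ⟩

lemma reForm_conjDiag (U : Matrix ι ι ℂ) (d : ι → ℝ) (e : ι → ℂ) :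
    reForm (conjDiag U d) e = ∑ i, Complex.normSq ((star U *ᵥ e) i) * d i := by
  have : star e ⬝ᵥ conjDiag U d *ᵥ e =
      star (star U *ᵥ e) ⬝ᵥ diagonal (fun i => (d i : ℂ)) *ᵥ (star U *ᵥ e) := by
    rw [conjDiag, ← mulVec_mulVec, ← mulVec_mulVec, dotProduct_mulVec, star_mulVec,
      star_eq_conjTranspose, conjTranspose_conjTranspose]
  rw [reForm, this, dotProduct, Complex.re_sum]
  refine Finset.sum_congr rfl fun i _ => ?_
  rw [mulVec_diagonal, Pi.star_apply, Complex.normSq_apply]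
  simp
  ring

lemma sum_normSq_star_mulVec {U : Matrix ι ι ℂ} (hU : U ∈ unitaryGroup ι ℂ) (e : ι → ℂ) :
    ∑ i, Complex.normSq ((star U *ᵥ e) i) = reForm 1 e := by
  rw [← conjDiag_one hU, reForm_conjDiag]
  simp

lemma reForm_one (e : ι → ℂ) : reForm 1 e = ∑ i, Complex.normSq (e i) := by
  rw [← sum_normSq_star_mulVec (one_mem _)]
  simp

lemma star_mulVec_mulVec_single {X : Matrix ι ι ℂ} (hX : X ∈ unitaryGroup ι ℂ) (i : ι) :
    star X *ᵥ (X *ᵥ Pi.single i 1) = Pi.single i 1 := by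
  rw [mulVec_mulVec, mem_unitaryGroup_iff'.1 hX, one_mulVec]

lemma reForm_conjDiag_mulVec_single {X : Matrix ι ι ℂ} (hX : X ∈ unitaryGroup ι ℂ) (d : ι → ℝ)
    (i : ι) : reForm (conjDiag X d) (X *ᵥ Pi.single i 1) = d i := by
  rw [reForm_conjDiag, star_mulVec_mulVec_single hX]
  simp [Pi.single_apply, apply_ite Complex.normSq]

lemma reForm_one_mulVec_single {X : Matrix ι ι ℂ} (hX : X ∈ unitaryGroup ι ℂ) (i : ι) :
    reForm 1 (X *ᵥ Pi.single i 1) = 1 := by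
  rw [← conjDiag_one hX, reForm_conjDiag_mulVec_single hX, Pi.one_apply]

lemma sum_normSq_row {T : Matrix ι ι ℂ} (hT : T ∈ unitaryGroup ι ℂ) (i : ι) :
    ∑ j, Complex.normSq (T i j) = 1 := by
  have h := congrFun (congrFun (mem_unitaryGroup_iff.1 hT) i) i
  rw [mul_apply, one_apply_eq] at h
  have h' := congrArg Complex.re h
  rw [Complex.re_sum] at h'
  simpa [Complex.normSq_apply] using h'

lemma charpoly_conjDiag {U : Matrix ι ι ℂ} (hU : U ∈ unitaryGroup ι ℂ) (d : ι → ℝ) :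
    (conjDiag U d).charpoly = ∏ i, (Polynomial.X - Polynomial.C (d i : ℂ)) := by
  rw [conjDiag, charpoly_mul_comm, ← mul_assoc, mem_unitaryGroup_iff'.1 hU, one_mul,
    charpoly_diagonal]

/-- Two coordinate subspaces, in two orthonormal bases, of dimensions with sum larger than that of
the space have a common unit vector. -/
lemma exists_unit_supported {W U : Matrix ι ι ℂ} (I J : Finset ι)
    (h : Fintype.card ι < I.card + J.card) :
    ∃ e : ι → ℂ, reForm 1 e = 1 ∧ (∀ i ∉ I, (star W *ᵥ e) i = 0) ∧
      ∀ j ∉ J, (star U *ᵥ e) j = 0 := by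
  -- `L` collects the coordinates required to vanish; there are fewer of them than the dimension, so
  -- its kernel is nonzero.
  let L : (ι → ℂ) →ₗ[ℂ] ({i // i ∉ I} → ℂ) × ({j // j ∉ J} → ℂ) :=
    ((LinearMap.funLeft ℂ ℂ Subtype.val) ∘ₗ (star W).mulVecLin).prod
      ((LinearMap.funLeft ℂ ℂ Subtype.val) ∘ₗ (star U).mulVecLin)
  have hdim : Module.finrank ℂ (({i // i ∉ I} → ℂ) × ({j // j ∉ J} → ℂ)) <
      Module.finrank ℂ (ι → ℂ) := by
    rw [Module.finrank_prod, Module.finrank_fintype_fun_eq_card,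
      Module.finrank_fintype_fun_eq_card, Module.finrank_fintype_fun_eq_card,
      Fintype.card_subtype_compl, Fintype.card_subtype_compl, Fintype.card_coe, Fintype.card_coe]
    have := Finset.card_le_univ I
    have := Finset.card_le_univ J
    omega
  obtain ⟨v, hv, hv0⟩ := (Submodule.ne_bot_iff _).1 (LinearMap.ker_ne_bot_of_finrank_lt (f := L) hdim)
  have hLv : L v = 0 := hv
  have hW : ∀ i ∉ I, (star W *ᵥ v) i = 0 := fun i hi =>
    congrFun (congrArg Prod.fst hLv) ⟨i, hi⟩
  have hU : ∀ j ∉ J, (star U *ᵥ v) j = 0 := fun j hj =>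
    congrFun (congrArg Prod.snd hLv) ⟨j, hj⟩
  set N := reForm 1 v with hN
  have hN0 : 0 < N := by
    obtain ⟨i, hi⟩ := Function.ne_iff.1 hv0
    rw [hN, reForm_one]
    exact Finset.sum_pos' (fun i _ => Complex.normSq_nonneg _)
      ⟨i, Finset.mem_univ i, Complex.normSq_pos.2 hi⟩
  refine ⟨((√N)⁻¹ : ℂ) • v, ?_, fun i hi => ?_, fun j hj => ?_⟩
  · have : ∑ i, Complex.normSq (v i) = N := by rw [hN, reForm_one]
    rw [reForm_one]
    simp only [Pi.smul_apply, smul_eq_mul, map_mul, ← Finset.mul_sum, this]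
    rw [map_inv₀, Complex.normSq_ofReal, Real.mul_self_sqrt hN0.le, inv_mul_cancel₀ hN0.ne']
  · rw [mulVec_smul, Pi.smul_apply, hW i hi, smul_zero]
  · rw [mulVec_smul, Pi.smul_apply, hU j hj, smul_zero]

/-- Compressing a positive linear map of a diagonalized matrix to a vector gives a non-negative
combination of the eigenvalues. -/
lemma exists_reForm_map_conjDiag {ι κ : Type*} [Fintype ι] [Fintype κ] [DecidableEq κ]
    (E : Matrix κ κ ℂ →ₚ[ℂ] Matrix ι ι ℂ) {V : Matrix κ κ ℂ} (hV : V ∈ unitaryGroup κ ℂ)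
    (e : ι → ℂ) :
    ∃ q : κ → ℝ, (∀ l, 0 ≤ q l) ∧ ∑ l, q l = reForm (E 1) e ∧
      ∀ d : κ → ℝ, reForm (E (conjDiag V d)) e = ∑ l, q l * d l := by
  let L : (κ → ℝ) →ₗ[ℝ] ℝ :=
    { toFun := fun d => reForm (E (conjDiag V d)) e
      map_add' := fun d d' => by rw [conjDiag_add, map_add, reForm_add]
      map_smul' := fun c d => by
        rw [conjDiag_smul, map_smul, reForm_smul, RingHom.id_apply, smul_eq_mul] }
  have hL : ∀ d, reForm (E (conjDiag V d)) e = ∑ l, L (Pi.single l 1) * d l := fun d => by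
    change L d = _
    rw [LinearMap.pi_apply_eq_sum_univ L d]
    refine Finset.sum_congr rfl fun l _ => ?_
    rw [smul_eq_mul, mul_comm]
    congr 2
    ext j
    simp [Pi.single_apply, eq_comm]
  refine ⟨fun l => L (Pi.single l 1), fun l => ?_, ?_, hL⟩
  · exact reForm_nonneg (E.map_nonneg (nonneg_iff_posSemidef.2
      (conjDiag_posSemidef V (Pi.single_nonneg.2 zero_le_one)))) e
  · rw [← conjDiag_one hV, hL]
    simp

/-- Positivity of `E` handles the positive and negative parts of `d` separately; signs do occur,
since `log Z` need not be positive. -/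
lemma isHermitian_map_conjDiag {ι κ : Type*} [Fintype κ] [DecidableEq κ]
    (E : Matrix κ κ ℂ →ₚ[ℂ] Matrix ι ι ℂ) (V : Matrix κ κ ℂ) (d : κ → ℝ) :
    (E (conjDiag V d)).IsHermitian := by
  have h : ∀ d : κ → ℝ, 0 ≤ d → (E (conjDiag V d)).IsHermitian := fun d hd =>
    (nonneg_iff_posSemidef.1 (E.map_nonneg (nonneg_iff_posSemidef.2
      (conjDiag_posSemidef V hd)))).isHermitian
  rw [← posPart_sub_negPart d, conjDiag_sub, map_sub]
  exact (h _ (posPart_nonneg d)).sub (h _ (negPart_nonneg d))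

end Matrix

/-! ### Eigenvalue lists, rearrangements and Jensen's inequality. -/

open Matrix

/-- Both lists are the roots of the characteristic polynomial. This lets any diagonalization, in any
order, compute the sorted eigenvalues. -/
lemma exists_perm_decEigenvalue {m : ℕ} {A U : Matrix (Fin m) (Fin m) ℂ} (hA : A.IsHermitian)
    (hU : U ∈ unitaryGroup (Fin m) ℂ) {d : Fin m → ℝ} (h : A = conjDiag U d) :
    ∃ σ : Equiv.Perm (Fin m), ∀ i, d (σ i) = decEigenvalue hA i := by
  have h1 := hA.roots_charpoly_eq_eigenvalues₀
  have h2 : A.charpoly.roots = Multiset.map (fun i => (d i : ℂ)) Finset.univ.val := by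
    rw [h, charpoly_conjDiag hU, Polynomial.roots_prod _ _
      (by simp [Finset.prod_ne_zero_iff, Polynomial.X_sub_C_ne_zero])]
    simp
  obtain ⟨σ, hσ⟩ := exists_equiv_of_map_univ_eq (h1.symm.trans h2)
  exact ⟨(finCongr (Fintype.card_fin m).symm).trans σ, fun i => Complex.ofReal_injective (hσ _)⟩

lemma decEigenvalue_antitone {m : ℕ} {A : Matrix (Fin m) (Fin m) ℂ} (hA : A.IsHermitian) :
    Antitone (decEigenvalue hA) := fun _ _ hij => hA.eigenvalues₀_antitone hij

/-- If any `k` entries of `α` and any `m + 1 - k` entries of `β` include comparable ones, then `α`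
dominates a rearrangement of `β`. -/
lemma exists_perm_le {m : ℕ} (α β : Fin m → ℝ)
    (h : ∀ I J : Finset (Fin m), m < I.card + J.card → ∃ i ∈ I, ∃ j ∈ J, β j ≤ α i) :
    ∃ σ : Equiv.Perm (Fin m), ∀ i, β (σ i) ≤ α i := by
  have hα := Tuple.monotone_sort α
  have hβ := Tuple.monotone_sort β
  refine ⟨(Tuple.sort α).symm.trans (Tuple.sort β), fun i => ?_⟩
  obtain ⟨k, rfl⟩ := (Tuple.sort α).surjective i
  rw [Equiv.trans_apply, Equiv.symm_apply_apply]
  -- The `k + 1` smallest values of `α` against the `m - k` largest of `β`: a comparable pair here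
  -- forces the comparison at sorted position `k`.
  obtain ⟨i, hi, j, hj, hij⟩ := h ((Finset.Iic k).map (Tuple.sort α).toEmbedding)
    ((Finset.Ici k).map (Tuple.sort β).toEmbedding) (by
      rw [Finset.card_map, Finset.card_map, Fin.card_Iic, Fin.card_Ici]; omega)
  simp only [Finset.mem_map, Finset.mem_Iic, Finset.mem_Ici] at hi hj
  obtain ⟨i, hi, rfl⟩ := hi
  obtain ⟨j, hj, rfl⟩ := hj
  exact (hβ hj).trans (hij.trans (hα hi))

/-- Geometric means of `β` with doubly stochastic weights have large products: any `k` of them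
have a product of at least that of the `k` smallest values of `β`. -/
lemma prod_le_prod_of_doublyStochastic {m : ℕ} {α β : Fin m → ℝ} {w : Fin m → Fin m → ℝ}
    (hβ : Monotone β) (hβ0 : ∀ j, 0 ≤ β j) (hα0 : ∀ i, 0 ≤ α i) (hw : ∀ i j, 0 ≤ w i j)
    (hrow : ∀ i, ∑ j, w i j = 1) (hcol : ∀ j, ∑ i, w i j = 1)
    (h : ∀ i, ∏ j, β j ^ w i j ≤ α i) {k : ℕ} (hk : 1 ≤ k) (hkm : k ≤ m) :
    ∏ j : Fin m with j.val < k, β j ≤ ∏ i : Fin m with i.val < k, α i := by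
  have hm : 0 < m := by omega
  rcases (hβ0 ⟨0, hm⟩).eq_or_lt with h0 | h0
  · rw [Finset.prod_eq_zero (i := ⟨0, hm⟩) (by simp; omega) h0.symm]
    exact Finset.prod_nonneg fun i _ => hα0 i
  have hpos : ∀ j, 0 < β j := fun j => h0.trans_le (hβ (Fin.mk_le_of_le_val (Nat.zero_le _)))
  refine le_trans ?_ (Finset.prod_le_prod (fun i _ =>
    Finset.prod_nonneg fun j _ => Real.rpow_nonneg (hβ0 j) _) fun i _ => h i)
  have hexp : ∀ j, β j = Real.exp (Real.log (β j)) := fun j => (Real.exp_log (hpos j)).symm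
  have hl : ∀ i, ∏ j, β j ^ w i j = Real.exp (∑ j, w i j * Real.log (β j)) := fun i => by
    rw [Real.exp_sum]
    refine Finset.prod_congr rfl fun j _ => ?_
    rw [Real.rpow_def_of_pos (hpos j), mul_comm]
  rw [Finset.prod_congr rfl fun j _ => hexp j, Finset.prod_congr rfl fun i _ => hl i,
    ← Real.exp_sum, ← Real.exp_sum, Real.exp_le_exp]
  set S : Finset (Fin m) := Finset.univ.filter fun i => i.val < k with hS
  -- Shifting by the logarithm of the `k`-th smallest value makes the terms in `S` nonpositive and
  -- the others nonnegative. Column sums over `S` lie in `[0, 1]`, so `key` holds termwise; the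
  -- shift cancels because the rows in `S` have total mass `k`.
  set θ := Real.log (β ⟨k - 1, by omega⟩) with hθ
  have hlog : Monotone fun j => Real.log (β j) := fun i j hij =>
    Real.log_le_log (hpos i) (hβ hij)
  have hcol1 : ∀ j, ∑ i ∈ S, w i j ≤ 1 := fun j => by
    rw [← hcol j]
    exact Finset.sum_le_sum_of_subset_of_nonneg (Finset.subset_univ _) fun i _ _ => hw i j
  have hcol0 : ∀ j, 0 ≤ ∑ i ∈ S, w i j := fun j => Finset.sum_nonneg fun i _ => hw i j
  have key : ∑ j ∈ S, (Real.log (β j) - θ) ≤ ∑ j, (∑ i ∈ S, w i j) * (Real.log (β j) - θ) := by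
    rw [hS, Finset.sum_filter]
    refine Finset.sum_le_sum fun j _ => ?_
    split_ifs with hj
    · have : Real.log (β j) ≤ θ := hlog (Fin.le_def.2 (by simp; omega))
      nlinarith [hcol1 j]
    · have : θ ≤ Real.log (β j) := hlog (Fin.le_def.2 (by simp; omega))
      exact mul_nonneg (hcol0 j) (by linarith)
  have hsum : ∑ j, (∑ i ∈ S, w i j) * (Real.log (β j) - θ) =
      ∑ i ∈ S, ∑ j, w i j * Real.log (β j) - ∑ i ∈ S, θ := by
    simp only [Finset.sum_mul]
    rw [Finset.sum_comm, ← Finset.sum_sub_distrib]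
    refine Finset.sum_congr rfl fun i _ => ?_
    simp only [mul_sub, Finset.sum_sub_distrib, ← Finset.sum_mul, hrow, one_mul]
  rw [hsum, Finset.sum_sub_distrib] at key
  linarith

/-- Deviations from the mean average to `0`. Nonzero weight of the chosen index is what later places
it in the support of a given vector. -/
lemma exists_le_sum_le {ι : Type*} [Fintype ι] {w b : ι → ℝ} (hw : ∀ i, 0 ≤ w i)
    (hw1 : ∑ i, w i = 1) :
    (∃ i, w i ≠ 0 ∧ b i ≤ ∑ i, w i * b i) ∧ ∃ i, w i ≠ 0 ∧ ∑ i, w i * b i ≤ b i := by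
  have hne : ∃ i, w i ≠ 0 := by
    by_contra! h
    simp [h] at hw1
  set c := ∑ i, w i * b i with hc
  have hsum : ∑ i, w i * (b i - c) = 0 := by
    simp only [mul_sub, Finset.sum_sub_distrib, ← Finset.sum_mul, hw1, one_mul]
    rw [← hc, sub_self]
  constructor
  all_goals
    by_contra! h
    obtain ⟨i₀, hi₀⟩ := hne
    have hi₀' := (hw i₀).lt_of_ne hi₀.symm
  · refine (Finset.sum_pos' (fun i _ => ?_) ⟨i₀, Finset.mem_univ _, ?_⟩).ne' hsum
    · by_cases hi : w i = 0
      · simp [hi]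
      · exact mul_nonneg (hw i) (sub_nonneg.2 (h i hi).le)
    · exact mul_pos hi₀' (sub_pos.2 (h i₀ hi₀))
  · refine (Finset.sum_neg' (fun i _ => ?_) ⟨i₀, Finset.mem_univ _, ?_⟩).ne hsum
    · by_cases hi : w i = 0
      · simp [hi]
      · exact mul_nonpos_of_nonneg_of_nonpos (hw i) (sub_nonpos.2 (h i hi).le)
    · exact mul_neg_of_pos_of_neg hi₀' (sub_neg.2 (h i₀ hi₀))

/-- The missing mass `1 - ∑ q i` goes to the point `0`, the extra element of `Option ι`. -/
lemma Convex.sum_mem_of_sum_le_one {ι : Type*} [Fintype ι] {D : Set ℝ} (hD : Convex ℝ D)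
    {q d : ι → ℝ} (hq : ∀ i, 0 ≤ q i) (hq1 : ∑ i, q i ≤ 1) (h0 : ∑ i, q i = 1 ∨ 0 ∈ D)
    (hd : ∀ i, d i ∈ D) : ∑ i, q i * d i ∈ D := by
  rcases h0 with h0 | h0
  · exact hD.sum_mem (fun i _ => hq i) h0 fun i _ => hd i
  · have := hD.sum_mem (t := Finset.univ) (w := fun o : Option ι => o.elim (1 - ∑ i, q i) q)
      (z := fun o => o.elim 0 d) (fun o _ => by cases o <;> simp [hq, hq1])
      (by simp [Fintype.sum_option]) (fun o _ => by cases o <;> simp [h0, hd])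
    simpa [Fintype.sum_option] using this

/-- Jensen with the missing mass at `0`; its term may be dropped because `0 ≤ G 0`. -/
lemma ConcaveOn.sum_le_of_sum_le_one {ι : Type*} [Fintype ι] {D : Set ℝ} {G : ℝ → ℝ}
    (hG : ConcaveOn ℝ D G) {q d : ι → ℝ} (hq : ∀ i, 0 ≤ q i) (hq1 : ∑ i, q i ≤ 1)
    (h0 : ∑ i, q i = 1 ∨ 0 ∈ D ∧ 0 ≤ G 0) (hd : ∀ i, d i ∈ D) :
    ∑ i, q i * G (d i) ≤ G (∑ i, q i * d i) := by
  rcases h0 with h0 | ⟨h0, hG0⟩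
  · exact hG.le_map_sum (fun i _ => hq i) h0 fun i _ => hd i
  · have := hG.le_map_sum (t := Finset.univ) (w := fun o : Option ι => o.elim (1 - ∑ i, q i) q)
      (p := fun o => o.elim 0 d) (fun o _ => by cases o <;> simp [hq, hq1])
      (by simp [Fintype.sum_option]) (fun o _ => by cases o <;> simp [h0, hd])
    simp only [Fintype.sum_option, Option.elim, smul_eq_mul, mul_zero, zero_add] at this
    exact le_trans (le_add_of_nonneg_left (mul_nonneg (sub_nonneg.2 hq1) hG0)) this

/-! ### From quadratic forms to eigenvalues. -/

/-- The product of `k` smallest eigenvalues of `F(S)` against those of `h(B)`, when the quadratic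
forms of `S` and `B` are compared through `F` and `h`. -/
lemma logSupermajorized_of_reForm_le {m : ℕ} {W U : Matrix (Fin m) (Fin m) ℂ}
    (hW : W ∈ unitaryGroup (Fin m) ℂ) (hU : U ∈ unitaryGroup (Fin m) ℂ) {s b : Fin m → ℝ}
    {F h : ℝ → ℝ}
    (hJ : ∀ e, reForm 1 e = 1 → h (reForm (conjDiag U b) e) ≤ F (reForm (conjDiag W s) e))
    (hF : ∀ i, 0 ≤ F (s i)) (hh : ∀ j, 0 ≤ h (b j))
    (hgm : ∀ w : Fin m → ℝ, (∀ j, 0 ≤ w j) → ∑ j, w j = 1 →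
      ∏ j, h (b j) ^ w j ≤ h (∑ j, w j * b j)) :
    LogSupermajorized (conjDiag W (F ∘ s)) (conjDiag U (h ∘ b)) := by
  refine ⟨conjDiag_posSemidef W hF, conjDiag_posSemidef U hh, fun k hk hkm => ?_⟩
  obtain ⟨σ, hσ⟩ := exists_perm_decEigenvalue (conjDiag_posSemidef W hF).isHermitian hW rfl
  obtain ⟨τ, hτ⟩ := exists_perm_decEigenvalue (conjDiag_posSemidef U hh).isHermitian hU rfl
  set T := star U * W with hT
  have hTu : T ∈ unitaryGroup (Fin m) ℂ := mul_mem (Unitary.star_mem hU) hW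
  have hrow : ∀ i, ∑ j, Complex.normSq (T j i) = 1 := fun i => by
    have := sum_normSq_row (Unitary.star_mem hTu) i
    simpa [star_apply] using this
  -- At the `i`-th eigenvector of `S`, the form of `B` averages `b` with weights `|T j i|²`, and
  -- `hgm` trades this average for a geometric mean.
  have hle : ∀ i, ∏ j, h (b j) ^ Complex.normSq (T j i) ≤ F (s i) := fun i => by
    refine (hgm _ (fun j => Complex.normSq_nonneg _) (hrow i)).trans ?_
    have h2 := hJ _ (reForm_one_mulVec_single hW i)
    rw [reForm_conjDiag_mulVec_single hW, reForm_conjDiag, mulVec_mulVec, ← hT] at h2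
    simpa only [mulVec_single_one, col_apply] using h2
  refine prod_le_prod_of_doublyStochastic
    (w := fun i j => Complex.normSq (T (τ j.rev) (σ i.rev)))
    (fun i j hij => decEigenvalue_antitone _ (Fin.rev_le_rev.2 hij))
    (fun j => ?_) (fun i => ?_) (fun i j => Complex.normSq_nonneg _) (fun i => ?_) (fun j => ?_)
    (fun i => ?_) hk hkm
  · rw [← hτ]; exact hh _
  · rw [← hσ]; exact hF _
  · rw [← hrow (σ i.rev)]
    exact (Fin.revPerm.trans τ).sum_comp fun j => Complex.normSq (T j (σ i.rev))
  · rw [← sum_normSq_row hTu (τ j.rev)]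
    exact (Fin.revPerm.trans σ).sum_comp fun i => Complex.normSq (T (τ j.rev) i)
  · rw [← hσ]
    simp only [← hτ]
    refine le_trans (le_of_eq ?_) (hle (σ i.rev))
    exact (Fin.revPerm.trans τ).prod_comp fun j => h (b j) ^ Complex.normSq (T j (σ i.rev))

/-- Spans of eigenvectors indexed by `I` and `J` share a unit vector once `I.card + J.card` exceeds
`m`. The form inequality there yields `i ∈ I` and `j ∈ J` with `h (b j) ≤ F (s i)`, which is what
`exists_perm_le` needs. -/
lemma exists_unitary_conj_le_of_reForm_le {m : ℕ} {W U : Matrix (Fin m) (Fin m) ℂ}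
    (hW : W ∈ unitaryGroup (Fin m) ℂ) (hU : U ∈ unitaryGroup (Fin m) ℂ) {s b : Fin m → ℝ}
    {F h : ℝ → ℝ} {D T : Set ℝ} (hD : Convex ℝ D) (hT : Convex ℝ T)
    (hsD : ∀ i, s i ∈ D) (hbT : ∀ j, b j ∈ T)
    (hJ : ∀ e, reForm 1 e = 1 → h (reForm (conjDiag U b) e) ≤ F (reForm (conjDiag W s) e))
    (hF : MonotoneOn F D ∨ AntitoneOn F D) (hh : MonotoneOn h T) :
    ∃ V ∈ unitaryGroup (Fin m) ℂ,
      V * conjDiag U (h ∘ b) * star V ≤ conjDiag W (F ∘ s) := by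
  obtain ⟨σ, hσ⟩ := exists_perm_le (F ∘ s) (h ∘ b) fun I J hIJ => by
    obtain ⟨e, he1, heI, heJ⟩ := exists_unit_supported (W := W) (U := U) I J (by simpa using hIJ)
    have hx0 : ∀ i, 0 ≤ Complex.normSq ((star W *ᵥ e) i) := fun i => Complex.normSq_nonneg _
    have hx1 := (sum_normSq_star_mulVec hW e).trans he1
    have hy0 : ∀ i, 0 ≤ Complex.normSq ((star U *ᵥ e) i) := fun i => Complex.normSq_nonneg _
    have hy1 := (sum_normSq_star_mulVec hU e).trans he1
    have hJe := hJ e he1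
    rw [reForm_conjDiag, reForm_conjDiag] at hJe
    have hmD := hD.sum_mem (fun i _ => hx0 i) hx1 fun i _ => hsD i
    have hmT := hT.sum_mem (fun i _ => hy0 i) hy1 fun i _ => hbT i
    simp only [smul_eq_mul] at hmD hmT
    obtain ⟨⟨i, hi, hi'⟩, i₂, hi₂, hi₂'⟩ := exists_le_sum_le (b := s) hx0 hx1
    obtain ⟨⟨j, hj, hj'⟩, -⟩ := exists_le_sum_le (b := b) hy0 hy1
    have hmem : ∀ i, Complex.normSq ((star W *ᵥ e) i) ≠ 0 → i ∈ I := fun i hi => by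
      by_contra hiI
      exact hi (by rw [heI i hiI, map_zero])
    have hjJ : j ∈ J := by
      by_contra hjJ
      exact hj (by rw [heJ j hjJ, map_zero])
    have hhj := (hh (hbT j) hmT hj').trans hJe
    -- The direction of monotonicity decides whether an `s i` above or below the mean is used.
    rcases hF with hF | hF
    · exact ⟨i₂, hmem i₂ hi₂, j, hjJ, hhj.trans (hF hmD (hsD i₂) hi₂')⟩
    · exact ⟨i, hmem i hi, j, hjJ, hhj.trans (hF (hsD i) hmD hi')⟩
  -- Permuting the columns of `U` by `σ` reorders the diagonal, so that it lies entrywise below `F ∘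
  -- s`.
  set U' : Matrix (Fin m) (Fin m) ℂ := U.submatrix id σ with hU'
  have hU'u : star U' * U' = 1 := by
    rw [hU', star_eq_conjTranspose, conjTranspose_submatrix,
      ← submatrix_mul _ _ σ id σ Function.bijective_id, ← star_eq_conjTranspose,
      mem_unitaryGroup_iff'.1 hU, submatrix_one_equiv]
  have hC : conjDiag U (h ∘ b) = conjDiag U' (h ∘ b ∘ σ) := by
    ext i j
    rw [conjDiag, conjDiag, mul_apply, mul_apply]
    simp only [hU', mul_diagonal, star_apply, submatrix_apply, id, Function.comp_apply]
    exact (Equiv.sum_comp σ fun l => U i l * ((h (b l) : ℝ) : ℂ) * star (U j l)).symm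
  refine ⟨W * star U', mul_mem hW (Unitary.star_mem (mem_unitaryGroup_iff'.2 hU'u)), ?_⟩
  have : W * star U' * conjDiag U' (h ∘ b ∘ σ) * star (W * star U') = conjDiag W (h ∘ b ∘ σ) := by
    rw [conjDiag, conjDiag, star_mul, star_star]
    calc _ = W * (star U' * U') * diagonal (fun i => (((h ∘ b ∘ σ) i : ℝ) : ℂ)) *
          (star U' * U') * star W := by simp only [mul_assoc]
      _ = _ := by rw [hU'u, mul_one, mul_one]
  rw [hC, this]
  exact conjDiag_mono W hσ

/-! ### Functional calculus and conclusion. -/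

/-- Every function is continuous on the finite spectrum. -/
lemma cfc_comp_of_isHermitian {n : ℕ} {A : Matrix (Fin n) (Fin n) ℂ} (hA : A.IsHermitian)
    (g f : ℝ → ℝ) : cfc g (cfc f A) = cfc (g ∘ f) A :=
  (cfc_comp g f A hA ((A.finite_real_spectrum.image f).continuousOn g)
    (A.finite_real_spectrum.continuousOn f)).symm

lemma spectrum_cfc_of_isHermitian {n : ℕ} {A : Matrix (Fin n) (Fin n) ℂ} (hA : A.IsHermitian)
    (f : ℝ → ℝ) : spectrum ℝ (cfc f A) = f '' spectrum ℝ A :=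
  cfc_map_spectrum f A hA (A.finite_real_spectrum.continuousOn f)

/-- The comparison of `f (h (E (φ Z)))` and `h (E (φ (f Z)))` when `f` becomes a concave function
`G` in the coordinate `φ`, with inverse `h`. -/
theorem comparison_of_concaveOn {n m : ℕ}
    (E : Matrix (Fin n) (Fin n) ℂ →ₚ[ℂ] Matrix (Fin m) (Fin m) ℂ) (hE : E 1 ≤ 1)
    {Ω D T : Set ℝ} {f φ h G : ℝ → ℝ} {Z : Matrix (Fin n) (Fin n) ℂ} (hZ : Z.IsHermitian)
    (hfΩ : ∀ x ∈ Ω, 0 ≤ f x) (hG : ConcaveOn ℝ D G) (hT : Convex ℝ T) (hDT : D ⊆ T)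
    (hGT : ∀ t ∈ D, G t ∈ T) (hh : MonotoneOn h T) (hh0 : ∀ t ∈ T, 0 ≤ h t)
    (hgm : ∀ b w : Fin m → ℝ, (∀ j, b j ∈ T) → (∀ j, 0 ≤ w j) → ∑ j, w j = 1 →
      ∏ j, h (b j) ^ w j ≤ h (∑ j, w j * b j))
    (hhΩ : ∀ t ∈ D, h t ∈ Ω) (hhG : ∀ t ∈ D, h (G t) = f (h t))
    (hφD : ∀ z ∈ spectrum ℝ Z, φ z ∈ D) (hGφ : ∀ z ∈ spectrum ℝ Z, G (φ z) = φ (f z))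
    (h0 : E 1 = 1 ∨ 0 ∈ D ∧ 0 ≤ G 0) :
    spectrum ℝ (cfc h (E (cfc φ Z))) ⊆ Ω ∧
    LogSupermajorized (cfc f (cfc h (E (cfc φ Z)))) (cfc h (E (cfc φ (cfc f Z)))) ∧
    (MonotoneOn f Ω ∨ AntitoneOn f Ω →
      ∃ V ∈ Matrix.unitaryGroup (Fin m) ℂ,
        V * cfc h (E (cfc φ (cfc f Z))) * star V ≤ cfc f (cfc h (E (cfc φ Z)))) := by
  obtain ⟨V, hV, z, hz, -, hcfc⟩ := hZ.exists_conjDiag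
  have hzs : ∀ l, z l ∈ spectrum ℝ Z := fun l => hz ▸ Set.mem_range_self l
  rw [cfc_comp_of_isHermitian hZ, hcfc, hcfc]
  have hGz : (φ ∘ f) ∘ z = G ∘ φ ∘ z := funext fun l => (hGφ _ (hzs l)).symm
  rw [hGz]
  have hS := isHermitian_map_conjDiag E V (φ ∘ z)
  have hB := isHermitian_map_conjDiag E V (G ∘ φ ∘ z)
  rw [cfc_comp_of_isHermitian hS]
  have hq1 : ∀ e, reForm 1 e = 1 → reForm (E 1) e ≤ 1 := fun e he => he ▸ reForm_mono hE e
  have hmem : ∀ {K : Set ℝ} {d : Fin n → ℝ}, Convex ℝ K → (E 1 = 1 ∨ 0 ∈ K) → (∀ l, d l ∈ K) →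
      ∀ e, reForm 1 e = 1 → reForm (E (conjDiag V d)) e ∈ K := by
    intro K d hK hK0 hd e he
    obtain ⟨q, hq, hqs, hqE⟩ := exists_reForm_map_conjDiag E hV e
    rw [hqE]
    exact hK.sum_mem_of_sum_le_one hq (hqs ▸ hq1 e he)
      (hK0.imp_left fun h => by rw [hqs, h, he]) hd
  -- The same weights `q` serve both forms, since both matrices are diagonal in the eigenbasis `V`
  -- of `Z`; Jensen applies.
  have hJ : ∀ e, reForm 1 e = 1 →
      reForm (E (conjDiag V (G ∘ φ ∘ z))) e ≤ G (reForm (E (conjDiag V (φ ∘ z))) e) := by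
    intro e he
    obtain ⟨q, hq, hqs, hqE⟩ := exists_reForm_map_conjDiag E hV e
    rw [hqE, hqE]
    exact hG.sum_le_of_sum_le_one hq (hqs ▸ hq1 e he)
      (h0.imp_left fun h => by rw [hqs, h, he]) fun l => hφD _ (hzs l)
  have h0D : E 1 = 1 ∨ 0 ∈ D := h0.imp_right And.left
  have hmemD := hmem (d := φ ∘ z) hG.1 h0D fun l => hφD _ (hzs l)
  have hmemT := hmem (d := G ∘ φ ∘ z) hT (h0D.imp_right fun h => hDT h) fun l => hGT _ (hφD _ (hzs l))
  obtain ⟨W, hW, s, hs, hSW, hScfc⟩ := hS.exists_conjDiag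
  obtain ⟨U, hU, b, hb, hBU, hBcfc⟩ := hB.exists_conjDiag
  have hsD : ∀ i, s i ∈ D := fun i => by
    rw [← reForm_conjDiag_mulVec_single hW s i, ← hSW]
    exact hmemD _ (reForm_one_mulVec_single hW i)
  have hbT : ∀ j, b j ∈ T := fun j => by
    rw [← reForm_conjDiag_mulVec_single hU b j, ← hBU]
    exact hmemT _ (reForm_one_mulVec_single hU j)
  have hJ' : ∀ e, reForm 1 e = 1 →
      h (reForm (conjDiag U b) e) ≤ (f ∘ h) (reForm (conjDiag W s) e) := fun e he => by
    rw [← hBU, ← hSW, Function.comp_apply, ← hhG _ (hmemD e he)]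
    exact hh (hmemT e he) (hGT _ (hmemD e he)) (hJ e he)
  refine ⟨?_, ?_, fun hf => ?_⟩
  · rw [spectrum_cfc_of_isHermitian hS, hs]
    rintro _ ⟨_, ⟨i, rfl⟩, rfl⟩
    exact hhΩ _ (hsD i)
  · rw [hScfc, hBcfc]
    exact logSupermajorized_of_reForm_le hW hU hJ' (fun i => hfΩ _ (hhΩ _ (hsD i)))
      (fun j => hh0 _ (hbT j)) fun w => hgm b w hbT
  · rw [hScfc, hBcfc]
    refine exists_unitary_conj_le_of_reForm_le hW hU hG.1 hT hsD hbT hJ' ?_ hh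
    have hhD : MonotoneOn h D := hh.mono hDT
    exact hf.imp (fun hf => hf.comp hhD hhΩ) fun hf => fun a ha b hb hab =>
      hf (hhΩ a ha) (hhΩ b hb) (hhD ha hb hab)

theorem theorem2p7 {n m : ℕ}
    (E : Matrix (Fin n) (Fin n) ℂ →ₚ[ℂ] Matrix (Fin m) (Fin m) ℂ) (hE : E 1 ≤ 1)
    (Ω : Set ℝ) (f : ℝ → ℝ) (hf : DoublyConcaveOn Ω f)
    (Z : Matrix (Fin n) (Fin n) ℂ) (hZ : Z.IsHermitian) (hZΩ : spectrum ℝ Z ⊆ Ω)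
    (p : ℝ)
    (hp : (0 < p ∧ p ≤ 1 ∧ (E 1 = 1 ∨ 0 ∈ Ω)) ∨
      (p = 0 ∧ E 1 = 1 ∧ IsUnit Z ∧ IsUnit (cfc f Z))) :
    spectrum ℝ (powerMap E p Z) ⊆ Ω ∧
    LogSupermajorized (cfc f (powerMap E p Z)) (powerMap E p (cfc f Z)) ∧
    (MonotoneOn f Ω ∨ AntitoneOn f Ω →
      ∃ V ∈ Matrix.unitaryGroup (Fin m) ℂ,
        V * powerMap E p (cfc f Z) * star V ≤ cfc f (powerMap E p Z)) := by
  rcases hp with ⟨hp, hp1, h0⟩ | ⟨rfl, h1, hZu, hfZu⟩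
  · simp only [powerMap, if_neg hp.ne']
    have hinv : ∀ t : ℝ, 0 ≤ t → (t ^ p) ^ (1 / p) = t := fun t ht => by
      rw [one_div, Real.rpow_rpow_inv ht hp.ne']
    refine comparison_of_concaveOn E hE (T := Set.Ici 0) hZ hf.nonneg (hf.concaveOn_rpow hp hp1)
      (convex_Ici 0) (fun t ht => ht.1)
      (fun t ht => Real.rpow_nonneg (hf.nonneg _ ht.2) p)
      (fun s hs t _ hst => Real.rpow_le_rpow hs hst (by positivity))
      (fun t ht => Real.rpow_nonneg ht _) ?_ (fun t ht => ht.2)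
      (fun t ht => hinv _ (hf.nonneg _ ht.2)) ?_ ?_ ?_
    · intro b w hb hw hw1
      have h := Real.geom_mean_le_arith_mean_weighted Finset.univ w b (fun j _ => hw j) hw1
        fun j _ => hb j
      refine le_trans (le_of_eq ?_) (Real.rpow_le_rpow
        (Finset.prod_nonneg fun j _ => Real.rpow_nonneg (hb j) _) h
        (show 0 ≤ 1 / p by positivity))
      rw [← Real.finsetProd_rpow _ _ fun j _ => Real.rpow_nonneg (hb j) _]
      refine Finset.prod_congr rfl fun j _ => ?_
      rw [← Real.rpow_mul (hb j), ← Real.rpow_mul (hb j), mul_comm]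
    · intro z hz
      have hz0 : 0 ≤ z := hf.subset_nonneg (hZΩ hz)
      exact ⟨Real.rpow_nonneg hz0 p, by rw [hinv z hz0]; exact hZΩ hz⟩
    · intro z hz
      simp only [hinv z (hf.subset_nonneg (hZΩ hz))]
    -- The coordinate `t ^ p` fixes `0`, so the sub-unital case can put its missing mass there.
    · refine h0.imp_right fun h0 => ?_
      have h00 : (0 : ℝ) ^ (1 / p) = 0 := Real.zero_rpow (by positivity)
      exact ⟨⟨le_rfl, by rwa [h00]⟩, Real.rpow_nonneg (hf.nonneg _ (by rwa [h00])) p⟩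
  · simp only [powerMap, if_true]
    -- Invertibility keeps the spectra of `Z` and `f(Z)` away from `0`, where `Real.log` takes its
    -- default value.
    have hz0 : ∀ z ∈ spectrum ℝ Z, 0 < z := fun z hz =>
      (hf.subset_nonneg (hZΩ hz)).lt_of_ne fun h =>
        spectrum.zero_notMem ℝ hZu (by rwa [h])
    have hfz0 : ∀ z ∈ spectrum ℝ Z, 0 < f z := fun z hz => by
      refine (hf.nonneg _ (hZΩ hz)).lt_of_ne fun h => spectrum.zero_notMem ℝ hfZu ?_
      rw [spectrum_cfc_of_isHermitian hZ]
      exact ⟨z, hz, h.symm⟩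
    refine comparison_of_concaveOn E hE (T := Set.univ) hZ hf.nonneg hf.concaveOn_log_comp_exp
      convex_univ (Set.subset_univ _) (fun _ _ => Set.mem_univ _) (Real.exp_monotone.monotoneOn _)
      (fun t _ => (Real.exp_pos t).le) ?_ (fun t ht => ht.1) (fun t ht => Real.exp_log ht.2)
      (fun z hz => ?_) (fun z hz => ?_) (Or.inl h1)
    -- For `h = exp` the geometric mean inequality is an equality.
    · intro b w _ _ _
      rw [Real.exp_sum]
      refine le_of_eq (Finset.prod_congr rfl fun j _ => ?_)
      rw [← Real.exp_mul, mul_comm]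
    · simp only [Set.mem_ofPred_eq, Real.exp_log (hz0 z hz)]
      exact ⟨hZΩ hz, hfz0 z hz⟩
    · simp only [Real.exp_log (hz0 z hz)]
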